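/- All rings are commutative with $1$. Let $R\subseteq S$ be a ring extension and let $[R,S]$ be the lattice of $R$-subalgebras of $S$, with intersection as meet and compositum (the subalgebra generated by the union) as join. Assume that (i) $R\subseteq S$ has FCP, i.e. every chain in $[R,S]$ is finite; (ii) $R\subseteq S$ is seminormal, i.e. for every $b\in S$, if $b^2\in R$ and $b^3\in R$, then $b\in R$; (iii) $R\subseteq S$ is infra-integral, i.e. $S$ is integral over $R$ and, for every prime ideal $Q$ of $S$, with $P=Q\cap R$, the residual field extension $\kappa_R(P)=R_P/PR_P\to \kappa_S(Q)=S_Q/QS_Q$ is an isomorphism. Then $R\subseteq S$ is distributive (i.e. in $[R,S]$ meet and join each distribute over the other) if and only if it is locally minimal, i.e. for every prime ideal $P$ of $R$ in the support $\mathrm{Supp}_R(S/R)=\{P\in\mathrm{Spec}(R) : (S/R)_P\neq 0\}$, the extension $R_P\subset S_P$ (where $S_P$ is the localization of $S$ at $R\setminus P$) is minimal, i.e. $R_P\neq S_P$ and the only $R_P$-subalgebras of $S_P$ are $R_P$ and $S_P$. -/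

import Mathlib

/-- The extension `R ⊆ S` has FCP: every chain of `R`-subalgebras of `S` is finite. -/
def HasFCP (R S : Type*) [CommRing R] [CommRing S] [Algebra R S] : Prop :=
  ∀ C : Set (Subalgebra R S), IsChain (· ≤ ·) C → C.Finite

/-- The extension `R ⊆ S` is seminormal: if `b ∈ S` and `b², b³ ∈ R`, then `b ∈ R`. -/
def IsSeminormalExtension (R S : Type*) [CommRing R] [CommRing S] [Algebra R S] : Prop :=
  ∀ b : S, b ^ 2 ∈ (algebraMap R S).range → b ^ 3 ∈ (algebraMap R S).range →
    b ∈ (algebraMap R S).range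

/-- The extension `R ⊆ S` is infra-integral: it is integral, and for every prime `Q` of `S` the
residual extension `κ(Q ∩ R) → κ(Q)` is an isomorphism. -/
def IsInfraIntegral (R S : Type*) [CommRing R] [CommRing S] [Algebra R S] : Prop :=
  Algebra.IsIntegral R S ∧
    ∀ (Q : Ideal S) [Q.IsPrime], Function.Bijective
      (Ideal.ResidueField.map (Q.comap (algebraMap R S)) Q (algebraMap R S) rfl)

/-- The extension `R ⊆ S` is distributive: in the lattice of `R`-subalgebras of `S`, intersection
and product (compositum) are each distributive with respect to the other. -/
def IsDistributiveExtension (R S : Type*) [CommRing R] [CommRing S] [Algebra R S] : Prop :=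
  (∀ T U V : Subalgebra R S, T ⊓ (U ⊔ V) = (T ⊓ U) ⊔ (T ⊓ V)) ∧
    (∀ T U V : Subalgebra R S, T ⊔ (U ⊓ V) = (T ⊔ U) ⊓ (T ⊔ V))

/-- The extension `A ⊂ B` is minimal: `A → B` is injective, `A ≠ B`, and the only `A`-subalgebras
of `B` are `A` (that is, `⊥`) and `B` (that is, `⊤`). -/
def IsMinimalExtension (A B : Type*) [CommRing A] [CommRing B] [Algebra A B] : Prop :=
  Function.Injective (algebraMap A B) ∧ (⊥ : Subalgebra A B) ≠ ⊤ ∧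
    ∀ T : Subalgebra A B, T = ⊥ ∨ T = ⊤

/-- The extension `R ⊆ S` is locally minimal: `R_P ⊂ S_P` is minimal for every prime `P` of `R`
in the support of the `R`-module `S / R`. Here `S_P` is the localization of the ring `S` at the
image of `R \ P`, with its canonical `R_P`-algebra structure. -/
def IsLocallyMinimal (R S : Type*) [CommRing R] [CommRing S] [Algebra R S] : Prop :=
  ∀ P ∈ Module.support R (S ⧸ LinearMap.range (Algebra.linearMap R S)),
    IsMinimalExtension (Localization.AtPrime P.asIdeal)
      (Localization (Algebra.algebraMapSubmonoid S P.asIdeal.primeCompl))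

/-!
Localization at a prime `P` of `R` is handled inside `S`: the `R_P`-subalgebras of `S_P` correspond
to the subalgebras of `S` saturated at `P`, so `R_P ⊂ S_P` is minimal exactly when the saturation of
every subalgebra is that of `R` or all of `S`, and these two differ
(`isMinimalExtension_localization_iff`).

If the extension is locally minimal, the distributive law can be checked on saturations at each
maximal ideal, where every subalgebra becomes that of `R` or all of `S`
(`isDistributiveExtension_of_isLocallyMinimal`).

For the converse, consider the conductor `C = (R : S)`. Seminormality makes it a radical ideal of
`S`. FCP makes `S` a finite `R`-module and the chain `R + xⁿS` stationary, so Nakayama's lemma shows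
`R / (C ∩ R)` to be von Neumann regular (`exists_mul_mem_conductor`). Hence a prime `P` in the
support of `S / R` is maximal, and the elements of `S` lying in all primes over `P` belong to the
saturation of `R` (`mem_saturationAt_bot_of_forall_mem`). In other words, locally at `P` the ring
`S / C` is a product of fields, each equal to `R / P` by infra-integrality. Three different factors
would give a copy of the partition lattice of a set with three elements, which is not distributive
(`IsDistributiveExtension.not_three_primes_over`). So there are at most two factors, and
`R / P ⊂ R / P × R / P` has no proper intermediate algebra (`saturationAt_eq_bot_or_top`).
-/

/-! ### Saturations and localizations of subalgebras -/

section Saturation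

variable {R S : Type*} [CommRing R] [CommRing S] [Algebra R S]

theorem algebraMap_smul_eq_smul_algebraMap {A : Type*} [CommRing A] [Algebra S A] [Algebra R A]
    [IsScalarTower R S A] (r : R) (s : S) : algebraMap S A (r • s) = r • algebraMap S A s := by
  rw [Algebra.algebraMap_eq_smul_one, Algebra.algebraMap_eq_smul_one, smul_assoc]

variable (P : Ideal R) [P.IsPrime]

/-- The saturation of a subalgebra `T` of `S` at a prime `P` of `R`: the elements of `S` that some
element of `R \ P` multiplies into `T`. It is the preimage in `S` of the localization `T_P`. -/
def Subalgebra.saturationAt (T : Subalgebra R S) : Subalgebra R S where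
  carrier := {x | ∃ s ∉ P, s • x ∈ T}
  mul_mem' := by
    rintro x y ⟨s, hs, hx⟩ ⟨u, hu, hy⟩
    refine ⟨s * u, P.primeCompl.mul_mem hs hu, ?_⟩
    have := T.mul_mem hx hy
    rwa [smul_mul_smul_comm] at this
  add_mem' := by
    rintro x y ⟨s, hs, hx⟩ ⟨u, hu, hy⟩
    refine ⟨s * u, P.primeCompl.mul_mem hs hu, ?_⟩
    rw [smul_add]
    refine T.add_mem ?_ ?_
    · rw [mul_comm, mul_smul]; exact T.smul_mem hx u
    · rw [mul_smul]; exact T.smul_mem hy s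
  algebraMap_mem' r := ⟨1, P.primeCompl.one_mem, by rw [one_smul]; exact T.algebraMap_mem r⟩

variable {P}

theorem Subalgebra.mem_saturationAt {T : Subalgebra R S} {x : S} :
    x ∈ T.saturationAt P ↔ ∃ s ∉ P, s • x ∈ T := Iff.rfl

theorem Subalgebra.le_saturationAt (T : Subalgebra R S) : T ≤ T.saturationAt P :=
  fun x hx => ⟨1, P.primeCompl.one_mem, by rwa [one_smul]⟩

theorem Subalgebra.mem_saturationAt_of_smul_mem {T : Subalgebra R S} {x : S} {s : R} (hs : s ∉ P)
    (h : s • x ∈ T.saturationAt P) : x ∈ T.saturationAt P := by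
  obtain ⟨u, hu, h⟩ := h
  exact ⟨u * s, P.primeCompl.mul_mem hu hs, by rwa [mul_smul]⟩

theorem Subalgebra.saturationAt_mono {T U : Subalgebra R S} (h : T ≤ U) :
    T.saturationAt P ≤ U.saturationAt P :=
  fun _ ⟨s, hs, hx⟩ => ⟨s, hs, h hx⟩

variable (P)

/-- The localization `T_P` of a subalgebra `T` of `S`, as an `R_P`-subalgebra of `S_P`. -/
def Subalgebra.localizedAt (T : Subalgebra R S) :
    Subalgebra (Localization.AtPrime P)
      (Localization (Algebra.algebraMapSubmonoid S P.primeCompl)) where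
  carrier := {x | ∃ s ∉ P, ∃ t ∈ T, s • x = algebraMap S _ t}
  mul_mem' := by
    rintro x y ⟨s, hs, t, ht, hx⟩ ⟨u, hu, v, hv, hy⟩
    exact ⟨s * u, P.primeCompl.mul_mem hs hu, t * v, T.mul_mem ht hv, by
      rw [map_mul, ← hx, ← hy, smul_mul_smul_comm]⟩
  add_mem' := by
    rintro x y ⟨s, hs, t, ht, hx⟩ ⟨u, hu, v, hv, hy⟩
    refine ⟨s * u, P.primeCompl.mul_mem hs hu, u • t + s • v,
      T.add_mem (T.smul_mem ht u) (T.smul_mem hv s), ?_⟩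
    rw [map_add, algebraMap_smul_eq_smul_algebraMap, algebraMap_smul_eq_smul_algebraMap, ← hx, ← hy,
      smul_add, mul_smul, mul_smul, smul_comm s u x]
  algebraMap_mem' r := by
    obtain ⟨a, s, rfl⟩ := IsLocalization.exists_mk'_eq P.primeCompl r
    refine ⟨s, s.2, algebraMap R S a, T.algebraMap_mem a, ?_⟩
    rw [Algebra.smul_def, ← IsScalarTower.algebraMap_apply,
      IsScalarTower.algebraMap_apply R (Localization.AtPrime P), ← map_mul,
      IsLocalization.mk'_spec', ← IsScalarTower.algebraMap_apply]

variable {P}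

theorem Subalgebra.algebraMap_mem_localizedAt_iff {T : Subalgebra R S} {x : S} :
    algebraMap S (Localization (Algebra.algebraMapSubmonoid S P.primeCompl)) x ∈
      T.localizedAt P ↔ x ∈ T.saturationAt P := by
  constructor
  · rintro ⟨s, hs, t, ht, h⟩
    rw [← algebraMap_smul_eq_smul_algebraMap, IsLocalization.eq_iff_exists
      (Algebra.algebraMapSubmonoid S P.primeCompl)] at h
    obtain ⟨⟨_, u, hu, rfl⟩, h⟩ := h
    refine ⟨u * s, P.primeCompl.mul_mem hu hs, ?_⟩
    rw [mul_smul, Algebra.smul_def, h, ← Algebra.smul_def]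
    exact T.smul_mem ht u
  · rintro ⟨s, hs, h⟩
    exact ⟨s, hs, s • x, h, (algebraMap_smul_eq_smul_algebraMap _ _).symm⟩

theorem Subalgebra.smul_mem_localized_iff
    {T' : Subalgebra (Localization.AtPrime P)
      (Localization (Algebra.algebraMapSubmonoid S P.primeCompl))}
    {x : Localization (Algebra.algebraMapSubmonoid S P.primeCompl)} {s : R} (hs : s ∉ P) :
    s • x ∈ T' ↔ x ∈ T' := by
  have key (r : R) : r • x = algebraMap R (Localization.AtPrime P) r • x :=
    (algebraMap_smul _ r x).symm
  constructor
  · intro h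
    rw [key] at h
    obtain ⟨v, hv⟩ := IsLocalization.map_units (Localization.AtPrime P) (⟨s, hs⟩ : P.primeCompl)
    have := T'.smul_mem h (↑v⁻¹ : Localization.AtPrime P)
    rwa [← mul_smul, ← hv, Units.inv_mul, one_smul] at this
  · intro h
    rw [key]
    exact T'.smul_mem h _

theorem Subalgebra.localizedAt_le_localizedAt_iff {T U : Subalgebra R S} :
    T.localizedAt P ≤ U.localizedAt P ↔ T.saturationAt P ≤ U.saturationAt P := by
  constructor
  · intro h x hx
    exact algebraMap_mem_localizedAt_iff.1 (h (algebraMap_mem_localizedAt_iff.2 hx))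
  · rintro h x ⟨s, hs, t, ht, hx⟩
    rw [← smul_mem_localized_iff hs, hx, algebraMap_mem_localizedAt_iff]
    exact h (T.le_saturationAt ht)

theorem Subalgebra.localizedAt_inj_iff {T U : Subalgebra R S} :
    T.localizedAt P = U.localizedAt P ↔ T.saturationAt P = U.saturationAt P := by
  simp only [le_antisymm_iff, localizedAt_le_localizedAt_iff]

theorem Subalgebra.localizedAt_surjective :
    Function.Surjective (Subalgebra.localizedAt (S := S) P) := by
  intro T'
  refine ⟨(T'.restrictScalars R).comap (IsScalarTower.toAlgHom R S _), ?_⟩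
  ext x
  constructor
  · rintro ⟨s, hs, t, ht, hx⟩
    rw [← smul_mem_localized_iff hs, hx]
    exact ht
  · intro hx
    obtain ⟨t, ⟨_, s, hs, rfl⟩, h⟩ :=
      IsLocalization.exists_mk'_eq (Algebra.algebraMapSubmonoid S P.primeCompl) x
    have h' : s • x = algebraMap S _ t := by
      rw [← h, ← algebraMap_smul S, Algebra.smul_def]
      exact IsLocalization.mk'_spec' _ t
        (⟨_, Algebra.mem_algebraMapSubmonoid_of_mem ⟨s, hs⟩⟩ :
          Algebra.algebraMapSubmonoid S P.primeCompl)
    refine ⟨s, hs, t, ?_, h'⟩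
    change algebraMap S _ t ∈ T'
    rw [← h']
    exact (smul_mem_localized_iff hs).2 hx

theorem Subalgebra.localizedAt_bot : (⊥ : Subalgebra R S).localizedAt P = ⊥ := by
  refine le_antisymm ?_ bot_le
  rintro x ⟨s, hs, t, ht, hx⟩
  rw [← smul_mem_localized_iff hs, hx]
  obtain ⟨r, rfl⟩ := Algebra.mem_bot.1 ht
  rw [← IsScalarTower.algebraMap_apply,
    IsScalarTower.algebraMap_apply R (Localization.AtPrime P)]
  exact algebraMap_mem _ _

theorem Subalgebra.localizedAt_top : (⊤ : Subalgebra R S).localizedAt P = ⊤ := by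
  obtain ⟨T, hT⟩ := localizedAt_surjective (S := S) (P := P) ⊤
  exact top_le_iff.1 (hT ▸ localizedAt_le_localizedAt_iff.2 (saturationAt_mono le_top))

theorem Subalgebra.saturationAt_top : (⊤ : Subalgebra R S).saturationAt P = ⊤ :=
  top_le_iff.1 (le_saturationAt _)

variable (P) in
/-- Minimality of `R_P ⊂ S_P`, read off in `S`. -/
theorem isMinimalExtension_localization_iff (hinj : Function.Injective (algebraMap R S)) :
    IsMinimalExtension (Localization.AtPrime P)
        (Localization (Algebra.algebraMapSubmonoid S P.primeCompl)) ↔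
      (⊥ : Subalgebra R S).saturationAt P ≠ ⊤ ∧
        ∀ T : Subalgebra R S, T.saturationAt P = (⊥ : Subalgebra R S).saturationAt P ∨
          T.saturationAt P = ⊤ := by
  have hinj' : Function.Injective (algebraMap (Localization.AtPrime P)
      (Localization (Algebra.algebraMapSubmonoid S P.primeCompl))) :=
    localizationAlgebra_injective _ _ hinj
  rw [IsMinimalExtension, and_iff_right hinj', Subalgebra.localizedAt_surjective.forall,
    ← Subalgebra.localizedAt_bot, ← Subalgebra.localizedAt_top]
  simp only [ne_eq, Subalgebra.localizedAt_inj_iff, Subalgebra.saturationAt_top]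

/-- A prime supports `S / R` exactly when `R_P ≠ S_P`. -/
theorem mem_support_quotient_iff {p : PrimeSpectrum R} :
    p ∈ Module.support R (S ⧸ LinearMap.range (Algebra.linearMap R S)) ↔
      (⊥ : Subalgebra R S).saturationAt p.asIdeal ≠ ⊤ := by
  rw [Module.mem_support_iff', Ne, Algebra.eq_top_iff, (Submodule.mkQ_surjective _).exists]
  push Not
  refine exists_congr fun x => ?_
  rw [Subalgebra.mem_saturationAt]
  push Not
  refine forall₂_congr fun r _ => not_congr ?_
  rw [← map_smul, Submodule.mkQ_apply, Submodule.Quotient.mk_eq_zero]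
  simp [Algebra.mem_bot]

end Saturation

/-! ### From local minimality to distributivity -/

section Distributivity

variable {R S : Type*} [CommRing R] [CommRing S] [Algebra R S]

/-- Membership in a subalgebra can be tested on saturations at maximal ideals. -/
theorem Subalgebra.mem_of_forall_mem_saturationAt {T : Subalgebra R S} {x : S}
    (h : ∀ (P : Ideal R) [P.IsMaximal], x ∈ T.saturationAt P) : x ∈ T := by
  by_contra hx
  have hI : (T.toSubmodule.colon {x} : Ideal R) ≠ ⊤ := by
    rw [Ideal.ne_top_iff_one, Submodule.mem_colon_singleton, one_smul]
    exact hx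
  obtain ⟨P, hP, hle⟩ := Ideal.exists_le_maximal _ hI
  obtain ⟨s, hs, hsx⟩ := h P
  exact hs (hle (Submodule.mem_colon_singleton.2 hsx))

theorem isDistributiveExtension_of_inf_sup_le
    (h : ∀ T U V : Subalgebra R S, T ⊓ (U ⊔ V) ≤ (T ⊓ U) ⊔ (T ⊓ V)) :
    IsDistributiveExtension R S := by
  let := DistribLattice.ofInfSupLe h
  exact ⟨fun T U V => inf_sup_left T U V, fun T U V => sup_inf_left T U V⟩

/-- Distributivity is a local property, and each localization of the lattice has at most two
elements. -/
theorem isDistributiveExtension_of_isLocallyMinimal (hinj : Function.Injective (algebraMap R S))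
    (h : IsLocallyMinimal R S) : IsDistributiveExtension R S := by
  refine isDistributiveExtension_of_inf_sup_le fun T U V x hx => ?_
  refine Subalgebra.mem_of_forall_mem_saturationAt fun P _ => ?_
  obtain ⟨hT, hUV⟩ := Algebra.mem_inf.1 hx
  have key (W : Subalgebra R S) : W.saturationAt P = (⊥ : Subalgebra R S).saturationAt P ∨
      W.saturationAt P = ⊤ := by
    by_cases hbot : (⊥ : Subalgebra R S).saturationAt P = ⊤
    · exact .inr (top_le_iff.1 (hbot ▸ Subalgebra.saturationAt_mono bot_le))
    · let p : PrimeSpectrum R := ⟨P, inferInstance⟩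
      exact ((isMinimalExtension_localization_iff P hinj).1
        (h p (mem_support_quotient_iff.2 hbot))).2 W
  have mem_of_top {W : Subalgebra R S} (hW : W.saturationAt P = ⊤) :
      x ∈ (T ⊓ W).saturationAt P := by
    obtain ⟨s, hs, hsx⟩ : x ∈ W.saturationAt P := hW ▸ Algebra.mem_top
    exact ⟨s, hs, T.smul_mem hT s, hsx⟩
  rcases key U with hU | hU
  · rcases key V with hV | hV
    · have hle : U ⊔ V ≤ (⊥ : Subalgebra R S).saturationAt P :=
        sup_le (hU ▸ U.le_saturationAt) (hV ▸ V.le_saturationAt)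
      exact Subalgebra.saturationAt_mono bot_le (hle hUV)
    · exact Subalgebra.saturationAt_mono le_sup_right (mem_of_top hV)
  · exact Subalgebra.saturationAt_mono le_sup_left (mem_of_top hU)

end Distributivity

/-! ### Finiteness of FCP extensions -/

section FCP

variable {R S : Type*} [CommRing R] [CommRing S] [Algebra R S]

theorem HasFCP.exists_eq_succ_of_antitone (h : HasFCP R S) {f : ℕ → Subalgebra R S}
    (hf : Antitone f) : ∃ n, f n = f (n + 1) := by
  by_contra! hne
  have hs : StrictAnti f := strictAnti_nat_of_succ_lt fun n =>
    lt_of_le_of_ne (hf n.le_succ) (hne n).symm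
  exact Set.infinite_range_of_injective hs.injective (h _ hf.isChain_range)

theorem HasFCP.wellFoundedGT (h : HasFCP R S) : WellFoundedGT (Subalgebra R S) := by
  rw [wellFoundedGT_iff_monotone_chain_condition]
  by_contra! ⟨f, hf⟩
  have hfin := h _ f.monotone.isChain_range
  obtain ⟨T, ⟨n, rfl⟩, hn⟩ := hfin.exists_maximal (Set.range_nonempty f)
  obtain ⟨m, hnm, hm⟩ := hf n
  exact hm (le_antisymm (f.monotone hnm) (hn ⟨m, rfl⟩ (f.monotone hnm)))

/-- A maximal finitely generated subalgebra is all of `S`. -/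
theorem HasFCP.finiteType (h : HasFCP R S) : Algebra.FiniteType R S := by
  have := h.wellFoundedGT
  obtain ⟨T, hT, hmax⟩ := wellFounded_gt.has_min
    {T : Subalgebra R S | T.FG} ⟨⊥, Subalgebra.fg_bot⟩
  suffices hT_top : T = ⊤ from ⟨hT_top ▸ hT⟩
  refine Algebra.eq_top_iff.2 fun x => ?_
  by_contra hx
  have hfg : (Algebra.adjoin R {x}).FG := ⟨{x}, by simp⟩
  refine hmax (T ⊔ Algebra.adjoin R {x}) (hT.sup hfg) ?_
  refine lt_of_le_of_ne le_sup_left fun heq => hx ?_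
  rw [heq]
  exact (le_sup_right : Algebra.adjoin R {x} ≤ _) (Algebra.subset_adjoin rfl)

end FCP

/-! ### The conductor of a seminormal FCP extension -/

section Conductor

variable {R S : Type*} [CommRing R] [CommRing S] [Algebra R S]

/-- The subalgebra `R + I` of `S`, for an ideal `I` of `S`. -/
def Ideal.addBase (R : Type*) {S : Type*} [CommRing R] [CommRing S] [Algebra R S] (I : Ideal S) :
    Subalgebra R S :=
  (⊥ : Subalgebra R (S ⧸ I)).comap (Ideal.Quotient.mkₐ R I)

theorem Ideal.mem_addBase {I : Ideal S} {x : S} :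
    x ∈ I.addBase R ↔ ∃ r : R, x - algebraMap R S r ∈ I := by
  rw [Ideal.addBase, Subalgebra.mem_comap, Algebra.mem_bot]
  refine exists_congr fun r => ?_
  rw [← Ideal.Quotient.eq]
  exact eq_comm

theorem Ideal.addBase_mono {I J : Ideal S} (h : I ≤ J) : I.addBase R ≤ J.addBase R := by
  intro x hx
  obtain ⟨r, hr⟩ := Ideal.mem_addBase.1 hx
  exact Ideal.mem_addBase.2 ⟨r, h hr⟩

theorem Ideal.mem_addBase_of_mem {I : Ideal S} {x : S} (h : x ∈ I) : x ∈ I.addBase R :=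
  Ideal.mem_addBase.2 ⟨0, by simpa using h⟩

variable (R S) in
/-- The conductor `(R : S)`, as an ideal of `S`. -/
def extensionConductor : Ideal S where
  carrier := {c | ∀ s : S, c * s ∈ (⊥ : Subalgebra R S)}
  add_mem' ha hb s := by rw [add_mul]; exact add_mem (ha s) (hb s)
  zero_mem' s := by rw [zero_mul]; exact zero_mem _
  smul_mem' a c hc s := by
    rw [smul_eq_mul, mul_comm a c, mul_assoc]
    exact hc (a * s)

/-- If `b² ∈ (R : S)`, then for every `s` both the square and the cube of `bs` lie in `R`. -/
theorem IsSeminormalExtension.isRadical_conductor (h : IsSeminormalExtension R S) :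
    (extensionConductor R S).IsRadical := by
  rw [Ideal.isRadical_iff_pow_one_lt 2 one_lt_two]
  intro b hb s
  refine Algebra.mem_bot.2 (h (b * s) ?_ ?_)
  · rw [mul_pow]
    exact Algebra.mem_bot.1 (hb (s ^ 2))
  · rw [show (b * s) ^ 3 = b ^ 2 * (b * s ^ 3) by ring]
    exact Algebra.mem_bot.1 (hb (b * s ^ 3))

/-- The ring `R` is von Neumann regular modulo the conductor. The subalgebras `R + xⁿS` become
stationary; then `x` acts surjectively on the finite module `(R + xⁿS) / R`, which Nakayama's
lemma shows to be annihilated by some `1 - xy`. -/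
theorem exists_mul_mem_conductor (hFCP : HasFCP R S) (hsem : IsSeminormalExtension R S)
    [Algebra.IsIntegral R S] (x : R) :
    ∃ y : R, algebraMap R S ((1 - x * y) * x) ∈ extensionConductor R S := by
  have := hFCP.finiteType
  have : Module.Finite R S := Algebra.IsIntegral.finite
  set a := algebraMap R S x with ha
  obtain ⟨n, hn⟩ := hFCP.exists_eq_succ_of_antitone
    (f := fun n => (Ideal.span {a ^ n}).addBase R) fun m n hmn => Ideal.addBase_mono
      (Ideal.span_singleton_le_span_singleton.2 (pow_dvd_pow a hmn))
  let N : Submodule R (S ⧸ LinearMap.range (Algebra.linearMap R S)) :=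
    LinearMap.range ((x ^ n) • (LinearMap.range (Algebra.linearMap R S)).mkQ)
  have hN : N ≤ Ideal.span {x} • N := by
    rintro _ ⟨s, rfl⟩
    obtain ⟨r, hr⟩ := Ideal.mem_addBase.1
      (hn.le (Ideal.mem_addBase_of_mem (Ideal.mem_span_singleton.2 (dvd_mul_right (a ^ n) s))))
    obtain ⟨t, ht⟩ := Ideal.mem_span_singleton.1 hr
    have heq : (x ^ n • (LinearMap.range (Algebra.linearMap R S)).mkQ) s =
        x • (x ^ n • (LinearMap.range (Algebra.linearMap R S)).mkQ) t := by
      rw [LinearMap.smul_apply, LinearMap.smul_apply, ← mul_smul, ← map_smul, ← map_smul,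
        ← sub_eq_zero, ← map_sub, Submodule.mkQ_apply, Submodule.Quotient.mk_eq_zero]
      refine ⟨r, ?_⟩
      rw [Algebra.linearMap_apply, Algebra.smul_def, Algebra.smul_def, map_mul, map_pow, ← ha]
      linear_combination -ht
    rw [heq]
    exact Submodule.smul_mem_smul (Ideal.mem_span_singleton_self x) ⟨t, rfl⟩
  have hfg : N.FG := Module.Finite.iff_fg.1 inferInstance
  obtain ⟨r, hr, hrN⟩ :=
    Submodule.exists_sub_one_mem_and_smul_eq_zero_of_fg_of_le_smul _ N hfg hN
  obtain ⟨y, hy⟩ := Ideal.mem_span_singleton.1 hr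
  refine ⟨-y, ?_⟩
  rw [show 1 - x * -y = r by linear_combination -hy]
  -- The conductor is radical and contains `r xⁿ`, which divides `(r x) ^ (n + 1)`.
  refine hsem.isRadical_conductor ⟨n + 1, ?_⟩
  have hc : algebraMap R S (r * x ^ n) ∈ extensionConductor R S := by
    intro s
    have := hrN _ ⟨s, rfl⟩
    rw [LinearMap.smul_apply, ← mul_smul, ← map_smul, Submodule.mkQ_apply,
      Submodule.Quotient.mk_eq_zero, Algebra.smul_def] at this
    obtain ⟨u, hu⟩ := this
    exact Algebra.mem_bot.2 ⟨u, hu⟩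
  rw [← map_pow, show (r * x) ^ (n + 1) = (r ^ n * x) * (r * x ^ n) by ring, map_mul]
  exact Ideal.mul_mem_left _ _ hc

theorem conductor_comap_le_of_saturationAt_bot_ne_top {P : Ideal R} [P.IsPrime]
    (hP : (⊥ : Subalgebra R S).saturationAt P ≠ ⊤) :
    (extensionConductor R S).comap (algebraMap R S) ≤ P := by
  intro c hc
  by_contra hcP
  refine hP (Algebra.eq_top_iff.2 fun s => ⟨c, hcP, ?_⟩)
  rw [Algebra.smul_def]
  exact hc s

/-- Primes in the support of `S / R` contain the conductor, modulo which `R` is von Neumann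
regular. -/
theorem isMaximal_of_saturationAt_bot_ne_top (hFCP : HasFCP R S)
    (hsem : IsSeminormalExtension R S) [Algebra.IsIntegral R S] {P : Ideal R} [hp : P.IsPrime]
    (hP : (⊥ : Subalgebra R S).saturationAt P ≠ ⊤) : P.IsMaximal := by
  refine Ideal.isMaximal_iff.2 ⟨(Ideal.ne_top_iff_one P).1 hp.ne_top, fun J x hPJ hxP hxJ => ?_⟩
  obtain ⟨y, hy⟩ := exists_mul_mem_conductor hFCP hsem x
  have h1 := (hp.mem_or_mem (conductor_comap_le_of_saturationAt_bot_ne_top hP hy)).resolve_right hxP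
  have := J.add_mem (hPJ h1) (J.mul_mem_right y hxJ)
  rwa [sub_add_cancel] at this

/-- An element of `S` lying in all primes over `P` lies in the localized conductor, hence in
the saturation of `R`. -/
theorem mem_saturationAt_bot_of_forall_mem (hFCP : HasFCP R S)
    (hsem : IsSeminormalExtension R S) [Algebra.IsIntegral R S] {P : Ideal R} [hp : P.IsMaximal]
    {b : S} (hb : ∀ Q : Ideal S, Q.IsPrime → Q.comap (algebraMap R S) = P → b ∈ Q) :
    b ∈ (⊥ : Subalgebra R S).saturationAt P := by
  have hrad : b ∈ (P.map (algebraMap R S)).radical := by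
    rw [Ideal.radical_eq_sInf, Ideal.mem_sInf]
    rintro Q ⟨hPQ, hQ⟩
    exact hb Q hQ (hp.eq_of_le (Ideal.IsPrime.ne_top inferInstance)
      (Ideal.map_le_iff_le_comap.1 hPQ)).symm
  obtain ⟨n, hn⟩ := hrad
  have key : ∀ z ∈ P.map (algebraMap R S), ∃ s ∉ P, s • z ∈ extensionConductor R S := by
    intro z hz
    induction hz using Submodule.span_induction with
    | mem z hz =>
      obtain ⟨x, hx, rfl⟩ := hz
      obtain ⟨y, hy⟩ := exists_mul_mem_conductor hFCP hsem x
      refine ⟨1 - x * y, fun h => (Ideal.ne_top_iff_one P).1 hp.ne_top ?_, ?_⟩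
      · have := P.add_mem h (P.mul_mem_right y hx)
        rwa [sub_add_cancel] at this
      · rwa [Algebra.smul_def, ← map_mul]
    | zero => exact ⟨1, P.primeCompl.one_mem, by simp⟩
    | add z w _ _ hz hw =>
      obtain ⟨s, hs, hz⟩ := hz
      obtain ⟨u, hu, hw⟩ := hw
      refine ⟨s * u, P.primeCompl.mul_mem hs hu, ?_⟩
      rw [smul_add]
      refine add_mem ?_ ?_
      · rw [mul_comm, mul_smul]; exact Submodule.smul_of_tower_mem _ u hz
      · rw [mul_smul]; exact Submodule.smul_of_tower_mem _ s hw
    | smul a z _ hz =>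
      obtain ⟨s, hs, hz⟩ := hz
      refine ⟨s, hs, ?_⟩
      rw [smul_comm]
      exact Submodule.smul_mem _ a hz
  obtain ⟨s, hs, hsb⟩ := key _ hn
  refine ⟨s, hs, ?_⟩
  have hc : s • b ∈ extensionConductor R S := by
    refine hsem.isRadical_conductor ⟨n + 1, ?_⟩
    rw [show (s • b) ^ (n + 1) = (s ^ n • b) * (s • b ^ n) by
      rw [smul_mul_smul_comm, smul_pow, pow_succ, pow_succ' b]]
    exact Ideal.mul_mem_left _ _ hsb
  simpa using hc 1

end Conductor

/-! ### Primes over a maximal ideal -/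

section Fibre

variable {R S : Type*} [CommRing R] [CommRing S] [Algebra R S]

/-- As `P` and `Q` are maximal, the isomorphism of residue fields is one of `R / P` with `S / Q`. -/
theorem IsInfraIntegral.exists_sub_mem (h : IsInfraIntegral R S) {P : Ideal R} [hP : P.IsMaximal]
    {Q : Ideal S} [Q.IsPrime] (hQ : Q.comap (algebraMap R S) = P) (s : S) :
    ∃ r : R, s - algebraMap R S r ∈ Q := by
  subst hQ
  obtain ⟨y, hy⟩ := (h.2 Q).2 (algebraMap S Q.ResidueField s)
  obtain ⟨r, rfl⟩ := Ideal.algebraMap_residueField_surjective _ y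
  refine ⟨r, ?_⟩
  rw [Ideal.ResidueField.map_algebraMap] at hy
  rw [← Ideal.algebraMap_residueField_eq_zero, map_sub, hy, sub_self]

/-- The subalgebras `R + (Q₁ ∩ Q₂)`, `R + (Q₁ ∩ Q₃)` and `R + (Q₂ ∩ Q₃)` have the same pairwise
intersections, and the first two generate `S`, so that distributivity would put the third inside
the first two. -/
theorem IsDistributiveExtension.not_three_primes_over (hd : IsDistributiveExtension R S)
    (h : IsInfraIntegral R S) {P : Ideal R} [P.IsMaximal] {Q₁ Q₂ Q₃ : Ideal S}
    [Q₁.IsMaximal] [Q₂.IsMaximal] [Q₃.IsMaximal] (h₁ : Q₁.comap (algebraMap R S) = P)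
    (h₂ : Q₂.comap (algebraMap R S) = P) (h₃ : Q₃.comap (algebraMap R S) = P)
    (h₁₂ : Q₁ ≠ Q₂) (h₁₃ : Q₁ ≠ Q₃) (h₂₃ : Q₂ ≠ Q₃) : False := by
  have hsup : (Q₁ ⊓ Q₂).addBase R ⊔ (Q₁ ⊓ Q₃).addBase R = ⊤ := by
    refine Algebra.eq_top_iff.2 fun s => ?_
    obtain ⟨r, hr⟩ := h.exists_sub_mem h₁ s
    obtain ⟨a, ha, b, hb, hab⟩ := Submodule.mem_sup.1
      ((Ideal.eq_top_iff_one _).1 (Ideal.IsMaximal.coprime_of_ne ‹_› ‹_› h₂₃))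
    have hs : s = algebraMap R S r + (s - algebraMap R S r) * a + (s - algebraMap R S r) * b := by
      linear_combination -(s - algebraMap R S r) * hab
    rw [hs]
    refine add_mem (add_mem (algebraMap_mem _ r) ?_) ?_
    · exact le_sup_left (a := (Q₁ ⊓ Q₂).addBase R) (Ideal.mem_addBase_of_mem
        ⟨Q₁.mul_mem_right _ hr, Q₂.mul_mem_left _ ha⟩)
    · exact le_sup_right (a := (Q₁ ⊓ Q₂).addBase R) (Ideal.mem_addBase_of_mem
        ⟨Q₁.mul_mem_right _ hr, Q₃.mul_mem_left _ hb⟩)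
  have hinf : (Q₂ ⊓ Q₃).addBase R ⊓ (Q₁ ⊓ Q₃).addBase R ≤ (Q₁ ⊓ Q₂).addBase R := by
    rintro x ⟨hx, hx'⟩
    obtain ⟨r, hr₂, hr₃⟩ := Ideal.mem_addBase.1 hx
    obtain ⟨r', hr₁', hr₃'⟩ := Ideal.mem_addBase.1 hx'
    have hP : r - r' ∈ P := by
      rw [← h₃, Ideal.mem_comap, map_sub]
      convert Q₃.sub_mem hr₃' hr₃ using 1
      ring
    refine Ideal.mem_addBase.2 ⟨r, ?_, hr₂⟩
    rw [← h₁, Ideal.mem_comap, map_sub] at hP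
    have hx₁ := Q₁.sub_mem hr₁' hP
    rwa [sub_sub, add_sub_cancel] at hx₁
  have hle : (Q₂ ⊓ Q₃).addBase R ≤ (Q₁ ⊓ Q₂).addBase R := by
    have := hd.1 ((Q₂ ⊓ Q₃).addBase R) ((Q₁ ⊓ Q₂).addBase R) ((Q₁ ⊓ Q₃).addBase R)
    rw [hsup, inf_top_eq] at this
    rw [this]
    exact sup_le inf_le_right hinf
  -- An element of `Q₂ ∩ Q₃` outside `Q₁` cannot lie in `R + (Q₁ ∩ Q₂)`.
  have hnot : ¬ Q₂ ⊓ Q₃ ≤ Q₁ := by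
    rw [Ideal.IsPrime.inf_le inferInstance]
    rintro (hle | hle)
    · exact h₁₂ (Ideal.IsMaximal.eq_of_le ‹_› (Ideal.IsPrime.ne_top inferInstance) hle).symm
    · exact h₁₃ (Ideal.IsMaximal.eq_of_le ‹_› (Ideal.IsPrime.ne_top inferInstance) hle).symm
  obtain ⟨e, he, he₁⟩ := Set.not_subset.1 hnot
  obtain ⟨r, hr₁, hr₂⟩ := Ideal.mem_addBase.1 (hle (Ideal.mem_addBase_of_mem he))
  have hr : r ∈ P := by
    rw [← h₂, Ideal.mem_comap]
    simpa using Q₂.sub_mem he.1 hr₂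
  rw [← h₁, Ideal.mem_comap] at hr
  exact he₁ (by simpa using Q₁.add_mem hr₁ hr)

/-- If at most two primes of `S` lie over `P`, then a subalgebra containing an element `t` outside
the saturation of `R` has saturation `S`: after subtracting an element of `R`, `t` vanishes
modulo one prime and not modulo the other. -/
theorem saturationAt_eq_bot_or_top (hFCP : HasFCP R S) (hsem : IsSeminormalExtension R S)
    (h : IsInfraIntegral R S) (hd : IsDistributiveExtension R S) {P : Ideal R} [P.IsMaximal]
    (T : Subalgebra R S) :
    T.saturationAt P = (⊥ : Subalgebra R S).saturationAt P ∨ T.saturationAt P = ⊤ := by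
  have := h.1
  refine or_iff_not_imp_left.2 fun hne => ?_
  have hnle : ¬ T.saturationAt P ≤ (⊥ : Subalgebra R S).saturationAt P :=
    fun hle => hne (le_antisymm hle (Subalgebra.saturationAt_mono bot_le))
  have hmax {Q : Ideal S} (hQ : Q.IsPrime) (hQP : Q.comap (algebraMap R S) = P) : Q.IsMaximal :=
    Ideal.isMaximal_of_isIntegral_of_isMaximal_comap Q (by rwa [hQP])
  obtain ⟨t, htT, ht⟩ := Set.not_subset.1 hnle
  obtain ⟨Q₁, hQ₁, h₁, -⟩ : ∃ Q : Ideal S, Q.IsPrime ∧ Q.comap (algebraMap R S) = P ∧ t ∉ Q := by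
    by_contra! hall
    exact ht (mem_saturationAt_bot_of_forall_mem hFCP hsem hall)
  obtain ⟨r, hr⟩ := h.exists_sub_mem h₁ t
  have hr_mem : t - algebraMap R S r ∈ T.saturationAt P := sub_mem htT (algebraMap_mem _ r)
  obtain ⟨Q₂, hQ₂, h₂, htQ₂⟩ : ∃ Q : Ideal S, Q.IsPrime ∧ Q.comap (algebraMap R S) = P ∧
      t - algebraMap R S r ∉ Q := by
    by_contra! hall
    have := add_mem (mem_saturationAt_bot_of_forall_mem hFCP hsem hall)
      (algebraMap_mem ((⊥ : Subalgebra R S).saturationAt P) r)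
    rw [sub_add_cancel] at this
    exact ht this
  have hne₁₂ : Q₁ ≠ Q₂ := by
    rintro rfl
    exact htQ₂ hr
  have htwo (b : S) (hb₁ : b ∈ Q₁) (hb₂ : b ∈ Q₂) : b ∈ (⊥ : Subalgebra R S).saturationAt P := by
    refine mem_saturationAt_bot_of_forall_mem hFCP hsem fun Q hQ hQP => ?_
    by_cases hQ1 : Q₁ = Q
    · exact hQ1 ▸ hb₁
    by_cases hQ2 : Q₂ = Q
    · exact hQ2 ▸ hb₂
    have := hmax hQ₁ h₁
    have := hmax hQ₂ h₂
    have := hmax hQ hQP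
    exact (hd.not_three_primes_over h h₁ h₂ hQP hne₁₂ hQ1 hQ2).elim
  obtain ⟨c, hc⟩ := h.exists_sub_mem h₂ (t - algebraMap R S r)
  have hcP : c ∉ P := by
    intro hcP
    rw [← h₂, Ideal.mem_comap] at hcP
    exact htQ₂ (by simpa using Q₂.add_mem hc hcP)
  refine Algebra.eq_top_iff.2 fun s => Subalgebra.mem_saturationAt_of_smul_mem hcP ?_
  obtain ⟨a, ha⟩ := h.exists_sub_mem h₁ s
  obtain ⟨b, hb⟩ := h.exists_sub_mem h₂ (s - algebraMap R S a)
  set f := algebraMap R S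
  -- `c (s - a) - b (t - r)` vanishes modulo both primes.
  have hz : f c * (s - f a) - f b * (t - f r) ∈ T.saturationAt P := by
    refine Subalgebra.saturationAt_mono bot_le (htwo _ ?_ ?_)
    · exact Q₁.sub_mem (Q₁.mul_mem_left _ ha) (Q₁.mul_mem_left _ hr)
    · convert Q₂.sub_mem (Q₂.mul_mem_left (f c) hb) (Q₂.mul_mem_left (f b) hc) using 1
      ring
  have hcs : c • s = (f c * (s - f a) - f b * (t - f r)) + f b * (t - f r) + f (c * a) := by
    rw [Algebra.smul_def, map_mul]
    ring
  rw [hcs]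
  exact add_mem (add_mem hz (mul_mem (algebraMap_mem _ b) hr_mem)) (algebraMap_mem _ _)

end Fibre

theorem mainTheorem5 {R S : Type*} [CommRing R] [CommRing S] [Algebra R S]
    (hinj : Function.Injective (algebraMap R S)) (hFCP : HasFCP R S)
    (hsem : IsSeminormalExtension R S) (hinf : IsInfraIntegral R S) :
    IsDistributiveExtension R S ↔ IsLocallyMinimal R S := by
  refine ⟨fun hd p hp => ?_, isDistributiveExtension_of_isLocallyMinimal hinj⟩
  have := hinf.1
  have hbot := mem_support_quotient_iff.1 hp
  have := isMaximal_of_saturationAt_bot_ne_top hFCP hsem hbot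
  exact (isMinimalExtension_localization_iff p.asIdeal hinj).2
    ⟨hbot, saturationAt_eq_bot_or_top hFCP hsem hinf hd⟩
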